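/- Let $T\ge 0$ and let $\Omega$ be one of the following spaces of functions $\omega:[0,T]\to[0,\infty)$: $D^+[0,T]$ (all càdlàg ones), $C^+[0,T]$ (all continuous ones), $R^+[0,T]$ (all right-continuous ones). *Filtration.* On $D^+[0,T]$ and $R^+[0,T]$, $\mathcal F_t$ is the universal completion of the smallest $\sigma$-algebra making all $\omega\mapsto\omega(s)$, $s\le t$, measurable; on $C^+[0,T]$, $\mathcal F_t$ is the trace of the $\sigma$-algebra $\mathcal F_t$ of $D^+[0,T]$. Let $X_t(\omega):=\omega(t)$. *Capital processes.* A simple trading strategy $G$ consists of an initial capital $c\in\mathbb R$, stopping times $\tau_1\le\tau_2\le\cdots$ with values in $[0,T]\cup\{\infty\}$, only finitely many of which are finite for each $\omega$, and bounded $\mathcal F_{\tau_n}$-measurable functions $h_n$. Its capital process is $$\mathcal K^G_t(\omega)=c+\sum_{n\ge1}h_n(\omega)\bigl(\omega(\tau_{n+1}\wedge t)-\omega(\tau_n\wedge t)\bigr).$$ (For $\Omega=C^+[0,T]$, strategies are defined on $D^+[0,T]$ and their capital processes are restricted to $C^+[0,T]$.) A positive capital process is a process $S$, with each $S_t:\Omega\to[0,\infty]$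 being $\mathcal F_t$-measurable, of the form $S_t=\sum_{m\ge1}\mathcal K^{G_m}_t$, where $\mathcal K^{G_m}_t(\omega)\ge0$ for all $m$, all $t\in[0,T]$ and all $\omega\in\Omega$, and the sum of the initial capitals $c_m$ of the $G_m$ converges. Its initial value $S_0$ does not depend on $\omega$. The upper probability of $E\subseteq\Omega$ is $\overline{\mathbb P}(E):=\inf\{S_0: S_T(\omega)\ge\mathbf 1_E(\omega)\text{ for all }\omega\in\Omega\}$, with $S$ ranging over the positive capital processes. A property of $\omega\in\Omega$ holds for typical $\omega$ if there is a positive capital process $S$ with $S_0=1$ and $S_T(\omega)=\infty$ for every $\omega\in\Omega$ at which the property fails. **Proposition.** Let $P$ be a probability measure on $(\Omega,\mathcal F_T)$ such that $(X_t)_{t\in[0,T]}$ is a martingale with respect to $P$ and $(\mathcal F_t)$. 1. If $E\in\mathcal F_T$ satisfies $P(E)=1$, then $\overline{\mathbb P}(E)=1$. 2. Consequently the game-theoretic notion of typicality is coherent with such $P$: every property that holds for typical $\omega\in\Omega$ holds $P$-almost surely. -/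

import Mathlib

open MeasureTheory ProbabilityTheory Set Filter
open scoped ENNReal Topology

namespace GameProb

noncomputable section

/-- The time interval `[0, T]`. -/
abbrev Time (T : ℝ) : Type := Set.Icc (0 : ℝ) T

/-- The three kinds of sample space: `D⁺[0,T]`, `C⁺[0,T]` and `R⁺[0,T]`. -/
inductive Kind where
  | cadlag
  | continuous
  | rightContinuous

/-- The set of paths of the given kind: nonnegative functions on `[0, T]` that are càdlàg
(right-continuous with finite left limits), continuous, or right-continuous. -/
def Kind.paths (T : ℝ) : Kind → Set (Time T → ℝ)
  | .cadlag => {ω | (∀ t, 0 ≤ ω t) ∧ (∀ t, ContinuousWithinAt ω (Set.Ioi t) t) ∧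
      ∀ t, ∃ l : ℝ, Tendsto ω (𝓝[<] t) (𝓝 l)}
  | .continuous => {ω | (∀ t, 0 ≤ ω t) ∧ Continuous ω}
  | .rightContinuous => {ω | (∀ t, 0 ≤ ω t) ∧ ∀ t, ContinuousWithinAt ω (Set.Ioi t) t}

/-- The kind of the space on which stopping times and positions are defined: trading strategies
on `C⁺[0,T]` are trading strategies on `D⁺[0,T]`, looked at on continuous paths only. -/
def Kind.base : Kind → Kind
  | .cadlag => .cadlag
  | .continuous => .cadlag
  | .rightContinuous => .rightContinuous

theorem Kind.paths_subset_base (T : ℝ) (k : Kind) : k.paths T ⊆ k.base.paths T := by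
  cases k with
  | cadlag => exact subset_rfl
  | rightContinuous => exact subset_rfl
  | continuous =>
    rintro ω ⟨h0, hc⟩
    exact ⟨h0, fun t => hc.continuousWithinAt,
      fun t => ⟨ω t, hc.continuousAt.tendsto.mono_left nhdsWithin_le_nhds⟩⟩

/-- The sample space `Ω`. (A separate type, so that the product σ-algebra is not picked up as
an instance.) -/
def Sample (T : ℝ) (k : Kind) : Type := {ω : Time T → ℝ // ω ∈ k.paths T}

/-- The coordinate process `X t ω = ω(t)`. -/
def coord {T : ℝ} {k : Kind} (t : Time T) (ω : Sample T k) : ℝ := ω.1 t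

/-- The inclusion of the sample space in its base space: `C⁺[0,T] ⊆ D⁺[0,T]`, and the identity
in the other two cases. -/
def toBase {T : ℝ} {k : Kind} (ω : Sample T k) : Sample T k.base :=
  ⟨ω.1, k.paths_subset_base T ω.2⟩

/-- The universal completion of a σ-algebra: the sets that are measurable for the completion of
every probability measure on it. -/
def universalCompletion {α : Type*} (m : MeasurableSpace α) : MeasurableSpace α where
  MeasurableSet' A := ∀ μ : @Measure α m, IsProbabilityMeasure μ → NullMeasurableSet A μ
  measurableSet_empty := fun _ _ => nullMeasurableSet_empty
  measurableSet_compl := fun _ hA μ hμ => (hA μ hμ).compl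
  measurableSet_iUnion := fun _ hA μ hμ => NullMeasurableSet.iUnion fun i => hA i μ hμ

theorem universalCompletion_mono {α : Type*} {m m' : MeasurableSpace α} (h : m ≤ m') :
    universalCompletion m ≤ universalCompletion m' := by
  intro A hA μ hμ
  obtain ⟨B, hB, hAB⟩ := hA (μ.trim h) ⟨by
    rw [trim_measurableSet_eq h MeasurableSet.univ]; exact hμ.measure_univ⟩
  exact ⟨B, h _ hB, ae_eq_of_ae_eq_trim hAB⟩

/-- `ℱ°_t`, the smallest σ-algebra on `Ω` for which all `ω ↦ ω(s)`, `s ≤ t`, are measurable. -/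
def rawSigma (T : ℝ) (k : Kind) (t : Time T) : MeasurableSpace (Sample T k) :=
  ⨆ s : Time T, ⨆ _ : s ≤ t, MeasurableSpace.comap (coord s) (borel ℝ)

/-- `ℱ_t`: the universal completion of `ℱ°_t` on `D⁺[0,T]` and on `R⁺[0,T]`, and the trace
on `C⁺[0,T]` of the σ-algebra `ℱ_t` of `D⁺[0,T]`. -/
def sigma (T : ℝ) (k : Kind) (t : Time T) : MeasurableSpace (Sample T k) :=
  MeasurableSpace.comap toBase (universalCompletion (rawSigma T k.base t))

theorem sigma_mono (T : ℝ) (k : Kind) : Monotone (sigma T k) := fun _ _ h =>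
  MeasurableSpace.comap_mono <| universalCompletion_mono <|
    iSup_mono fun _ => iSup_mono' fun hs => ⟨hs.trans h, le_rfl⟩

variable {T : ℝ} [Fact (0 ≤ T)] {k : Kind}

/-- The σ-algebra of events, `ℱ_T`. -/
instance : MeasurableSpace (Sample T k) := sigma T k ⊤

/-- The filtration `(ℱ_t)`. -/
def filt (T : ℝ) [Fact (0 ≤ T)] (k : Kind) :
    Filtration (Time T) (inferInstance : MeasurableSpace (Sample T k)) where
  seq := sigma T k
  mono' := sigma_mono T k
  le' _ := sigma_mono T k le_top

/-- A simple trading strategy: an initial capital `c`, an increasing sequence of stopping times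
`τ n` with values in `[0, T] ∪ {∞}`, only finitely many of which are finite along each path, and
for each `n` a bounded `ℱ_{τ n}`-measurable position `h n`. The numbering starts from `0`. -/
structure SimpleStrategy (T : ℝ) [Fact (0 ≤ T)] (k : Kind) where
  c : ℝ
  τ : ℕ → Sample T k → WithTop (Time T)
  isStoppingTime : ∀ n, IsStoppingTime (filt T k) (τ n)
  monotone : ∀ ω, Monotone fun n => τ n ω
  finite : ∀ ω, {n | τ n ω ≠ ⊤}.Finite
  h : ℕ → Sample T k → ℝ
  measurable : ∀ n, Measurable[(isStoppingTime n).measurableSpace] (h n)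
  bounded : ∀ n, ∃ C : ℝ, ∀ ω, |h n ω| ≤ C

/-- The simple capital process
`c + ∑ₙ hₙ(ω) (ω(τₙ₊₁ ∧ t) - ω(τₙ ∧ t))`; only finitely many terms are non-zero. -/
def SimpleStrategy.capital (G : SimpleStrategy T k) (t : Time T) (ω : Sample T k) : ℝ :=
  G.c + ∑ᶠ n : ℕ, G.h n ω *
    (stoppedProcess coord (G.τ (n + 1)) t ω - stoppedProcess coord (G.τ n) t ω)

/-- Positive capital processes on `Ω`: sums of countably many simple capital processes that are
nonnegative on `Ω` and have a summable sequence of initial capitals. The value `∞` is allowed. -/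
def IsPositiveCapitalProcess (S : Time T → Sample T k → ℝ≥0∞) : Prop :=
  (∀ t, Measurable[filt T k t] (S t)) ∧
  ∃ G : ℕ → SimpleStrategy T k.base,
    (∀ m t (ω : Sample T k), 0 ≤ (G m).capital t (toBase ω)) ∧
    (Summable fun m => (G m).c) ∧
    ∀ t (ω : Sample T k), S t ω = ∑' m, ENNReal.ofReal ((G m).capital t (toBase ω))

/-- The upper probability of `E`: the infimum of the initial values `S_0` (which do not depend on
the path) of the positive capital processes `S` with `S_T ≥ 1_E` on `Ω`. -/
def upperProb (E : Set (Sample T k)) : ℝ≥0∞ :=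
  sInf {x | ∃ S : Time T → Sample T k → ℝ≥0∞, IsPositiveCapitalProcess S ∧
    (∀ ω, S ⊥ ω = x) ∧ ∀ ω, E.indicator (fun _ => (1 : ℝ≥0∞)) ω ≤ S ⊤ ω}

/-- A set is null if some positive capital process starts from `1` and is infinite at time `T` on
the whole set. -/
def IsNull (N : Set (Sample T k)) : Prop :=
  ∃ S : Time T → Sample T k → ℝ≥0∞, IsPositiveCapitalProcess S ∧
    (∀ ω, S ⊥ ω = 1) ∧ ∀ ω ∈ N, S ⊤ ω = ∞

/-- A property holds for typical paths if it fails only on a null set. -/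
def Typically (p : Sample T k → Prop) : Prop := IsNull {ω | ¬ p ω}

end

end GameProb

/-!
The point is that every positive capital process `S` satisfies `E_P[S_T] ≤ S_0`
(`GameProb.IsPositiveCapitalProcess.lintegral_top_le`). If `S_T ≥ 1_E`, this gives `P(E) ≤ S_0`,
hence `P(E) ≤ upperProb E`; the opposite bound `upperProb E ≤ 1` is witnessed by the constant
process `1`. If `S_0 = 1` and `S_T = ∞` on a set, this gives `S_T < ∞` almost surely, so that the
set is contained in a `P`-null set.

By monotone convergence it is enough to treat one simple capital process `K` that is nonnegative
on `Ω`. Stop it at the `N`-th stopping time: `K_{τ_N ∧ T}` is a finite sum of terms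
`h_n (X_{τ_{n+1} ∧ T} - X_{τ_n ∧ T})`, so optional sampling shows that its expectation is the
initial capital `c`. It is nonnegative, being a value of `K` at some time along each path, and it
equals `K_T` for `N` large, because only finitely many `τ_n` are finite. Fatou's lemma gives
`E_P[K_T] ≤ c`.

Optional sampling is needed in the form `E[h X_{τ ∧ T}] = E[h X_T]`, for `h` bounded and
`ℱ_τ`-measurable, in continuous time and for a filtration that need be neither right-continuous
nor `P`-complete (`GameProb.integrable_and_integral_mul_stoppedProcess_top`). The stopping time `τ` is
rounded up to the next point `τ'` of a finite grid. Rounding strictly upwards makes `{τ' ≤ t}` an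
event of the form `{τ < q}` with `q ≤ t`, for `t < T`, so that no right-continuity of the filtration is used.
Then `h X_{τ'}` is the conditional expectation of `h X_T` given `ℱ_{τ'}`. As the mesh goes to zero
`X_{τ'} → X_{τ ∧ T}` by right-continuity of the paths, and conditional expectations of one
integrable variable are uniformly integrable, so the expectations converge as well.

For continuous paths the strategies live on the càdlàg space; restricting one along the inclusion
gives a strategy on `Ω` itself (`GameProb.SimpleStrategy.restrict`), because the filtration on
`Ω` is the trace of the one on the base space.
-/

namespace GameProb

/-! ### Optional sampling for right-continuous martingales on `[0, T]` -/

section OptionalSampling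

variable {Ω : Type*} {m : MeasurableSpace Ω} {P : Measure Ω} [IsProbabilityMeasure P]

/-- Conditional expectations of `Z` are uniformly integrable, so no mass is lost in a pointwise
limit. The σ-algebras need not be nested. -/
theorem integrable_and_integral_eq_of_tendsto_condExp {Z Y : Ω → ℝ} (hZ : Integrable Z P)
    {𝒢 : ℕ → MeasurableSpace Ω} (h𝒢 : ∀ n, 𝒢 n ≤ m)
    (hY : ∀ᵐ ω ∂P, Tendsto (fun n => (P[Z | 𝒢 n]) ω) atTop (𝓝 (Y ω))) :
    Integrable Y P ∧ ∫ ω, Y ω ∂P = ∫ ω, Z ω ∂P := by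
  have hUI := hZ.uniformIntegrable_condExp h𝒢
  have hmem : MemLp Y 1 P := hUI.memLp_of_ae_tendsto hY
  have hint : Integrable Y P := memLp_one_iff_integrable.1 hmem
  refine ⟨hint, ?_⟩
  have hL := tendsto_Lp_finite_of_tendsto_ae le_rfl ENNReal.one_ne_top hUI.1 hmem hUI.2.1 hY
  have h := tendsto_integral_of_L1' Y hint.1
    (Eventually.of_forall fun _ => integrable_condExp) hL
  simp only [fun n => integral_condExp (f := Z) (μ := P) (h𝒢 n)] at h
  exact tendsto_nhds_unique h tendsto_const_nhds |>.symm ▸ rfl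

variable {T : ℝ} [Fact (0 ≤ T)]

/-- The time `s ∧ T`, as an element of `[0, T]`. -/
noncomputable def capTime (s : WithTop (Time T)) : Time T :=
  (min ((⊤ : Time T) : WithTop (Time T)) s).untopA

@[simp] theorem capTime_top : capTime (⊤ : WithTop (Time T)) = ⊤ := by simp [capTime]

@[simp] theorem capTime_coe (a : Time T) : capTime (a : WithTop (Time T)) = a := by
  rw [capTime, min_eq_right (by exact_mod_cast le_top)]; rfl

/-- The grid point `(j / (n + 1)) ∧ T`. -/
noncomputable def gridPoint (T : ℝ) [Fact (0 ≤ T)] (n j : ℕ) : Time T :=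
  ⟨min T (j / (n + 1)), le_min Fact.out (by positivity), min_le_left _ _⟩

/-- The first point of the grid `{(j / (n + 1)) ∧ T}` strictly after `s`, or `T` if there is none.
The value at `s = ∞` is `T`. -/
noncomputable def nextGridPoint (n : ℕ) (s : WithTop (Time T)) : Time T :=
  s.recTopCoe ⊤ fun a => gridPoint T n (⌊(n + 1 : ℝ) * a.1⌋₊ + 1)

@[simp] theorem nextGridPoint_top (n : ℕ) : nextGridPoint n (⊤ : WithTop (Time T)) = ⊤ := rfl

theorem nextGridPoint_coe (n : ℕ) (a : Time T) :
    nextGridPoint n (a : WithTop (Time T)) = gridPoint T n (⌊(n + 1 : ℝ) * a.1⌋₊ + 1) := rfl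

theorem countable_range_nextGridPoint (n : ℕ) :
    (range (nextGridPoint n : WithTop (Time T) → Time T)).Countable := by
  refine ((countable_range (gridPoint T n)).insert ⊤).mono ?_
  rintro _ ⟨s, rfl⟩
  cases s with
  | top => exact mem_insert _ _
  | coe a => exact mem_insert_of_mem _ (mem_range_self _)

theorem le_nextGridPoint (n : ℕ) (a : Time T) : a ≤ nextGridPoint n (a : WithTop (Time T)) := by
  rw [nextGridPoint_coe, ← Subtype.coe_le_coe, gridPoint]
  refine le_min a.2.2 ?_
  rw [le_div_iff₀ (by positivity), mul_comm]
  exact_mod_cast (Nat.lt_floor_add_one ((n + 1 : ℝ) * a.1)).le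

theorem tendsto_nextGridPoint (a : Time T) :
    Tendsto (fun n => nextGridPoint n (a : WithTop (Time T))) atTop (𝓝 a) := by
  rw [tendsto_subtype_rng]
  have h : Tendsto (fun n : ℕ => a.1 + 1 / ((n : ℝ) + 1)) atTop (𝓝 a.1) := by
    simpa using tendsto_one_div_add_atTop_nhds_zero_nat.const_add a.1
  refine tendsto_of_tendsto_of_tendsto_of_le_of_le tendsto_const_nhds h
    (fun n => le_nextGridPoint n a) fun n => ?_
  change min T _ ≤ _
  refine (min_le_right _ _).trans ?_
  have h0 : (0 : ℝ) ≤ (n + 1 : ℝ) * a.1 := mul_nonneg (by positivity) a.2.1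
  rw [div_le_iff₀ (by positivity), add_mul a.1, one_div_mul_cancel (by positivity), mul_comm a.1]
  push_cast
  linarith [Nat.floor_le h0]

/-- Since the rounding is strictly upwards, `{nextGridPoint n τ ≤ i}` is an event `{τ < q}` with
`q ≤ i`; this is what makes the rounded time a stopping time. -/
theorem nextGridPoint_le_iff (n : ℕ) {i : Time T} (hi : i < ⊤) (s : WithTop (Time T)) :
    nextGridPoint n s ≤ i ↔ s < (gridPoint T n ⌊(n + 1 : ℝ) * i.1⌋₊ : WithTop (Time T)) := by
  have hiT : i.1 < T := hi
  have h0 : (0 : ℝ) ≤ (n + 1 : ℝ) * i.1 := mul_nonneg (by positivity) i.2.1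
  have hn : (0 : ℝ) < n + 1 := by positivity
  cases s with
  | top => simp [hi.ne]
  | coe a =>
    have ha : (0 : ℝ) ≤ (n + 1 : ℝ) * a.1 := mul_nonneg (by positivity) a.2.1
    rw [nextGridPoint_coe, WithTop.coe_lt_coe, ← Subtype.coe_le_coe, ← Subtype.coe_lt_coe]
    change min T _ ≤ i.1 ↔ a.1 < min T _
    have hq : ((⌊(n + 1 : ℝ) * i.1⌋₊ : ℕ) : ℝ) / (n + 1) ≤ i.1 := by
      rw [div_le_iff₀ hn, mul_comm i.1]; exact Nat.floor_le h0
    rw [min_le_iff, or_iff_right hiT.not_ge, min_eq_right (hq.trans hiT.le), div_le_iff₀ hn,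
      lt_div_iff₀ hn, mul_comm i.1, mul_comm a.1, ← Nat.le_floor_iff h0, ← Nat.floor_lt ha,
      Nat.succ_le_iff]

theorem gridPoint_floor_le (n : ℕ) (i : Time T) : gridPoint T n ⌊(n + 1 : ℝ) * i.1⌋₊ ≤ i := by
  rw [← Subtype.coe_le_coe]
  refine (min_le_right _ _).trans ?_
  rw [div_le_iff₀ (by positivity), mul_comm i.1]
  exact Nat.floor_le (mul_nonneg (by positivity) i.2.1)

variable {ℱ : Filtration (Time T) m} {τ : Ω → WithTop (Time T)}

theorem isStoppingTime_nextGridPoint (hτ : IsStoppingTime ℱ τ) (n : ℕ) :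
    IsStoppingTime ℱ fun ω => (nextGridPoint n (τ ω) : WithTop (Time T)) := by
  intro i
  simp only [WithTop.coe_le_coe]
  rcases eq_or_lt_of_le (le_top : i ≤ ⊤) with rfl | hi
  · simp
  · simp only [nextGridPoint_le_iff n hi]
    exact hτ.measurableSet_lt_le (gridPoint_floor_le n i)

/-- The rounded stopping time is `T`, not `∞`, where `τ = ∞`; the `σ`-algebras are nested
nevertheless, since `ℱ_τ` contains only events of `ℱ_T`. -/
theorem measurableSpace_le_nextGridPoint (hτ : IsStoppingTime ℱ τ) (n : ℕ) :
    hτ.measurableSpace ≤ (isStoppingTime_nextGridPoint hτ n).measurableSpace := by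
  intro A hA
  refine ⟨hA.1, fun i => ?_⟩
  rcases eq_or_lt_of_le (le_top : i ≤ ⊤) with rfl | hi
  · have : (⨆ t, ℱ t) ≤ ℱ ⊤ := iSup_le fun t => ℱ.mono le_top
    exact (this _ hA.1).inter (isStoppingTime_nextGridPoint hτ n ⊤)
  · have hsub : A ∩ {ω | (nextGridPoint n (τ ω) : WithTop (Time T)) ≤ i} =
        (A ∩ {ω | τ ω ≤ i}) ∩ {ω | (nextGridPoint n (τ ω) : WithTop (Time T)) ≤ i} := by
      ext ω
      simp only [mem_inter_iff, mem_ofPred_eq, WithTop.coe_le_coe]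
      refine ⟨fun ⟨h1, h2⟩ => ⟨⟨h1, ?_⟩, h2⟩, fun h => ⟨h.1.1, h.2⟩⟩
      exact ((nextGridPoint_le_iff n hi _).1 h2).le.trans
        (WithTop.coe_le_coe.2 (gridPoint_floor_le n i))
    rw [hsub]
    exact (hA.2 i).inter (isStoppingTime_nextGridPoint hτ n i)

theorem tendsto_apply_nextGridPoint {x : Time T → ℝ}
    (hx : ∀ t, ContinuousWithinAt x (Ioi t) t) (s : WithTop (Time T)) :
    Tendsto (fun n => x (nextGridPoint n s)) atTop (𝓝 (x (capTime s))) := by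
  cases s with
  | top => simp
  | coe a =>
    rw [capTime_coe]
    have h : ContinuousWithinAt x (Ici a) a := continuousWithinAt_Ioi_iff_Ici.1 (hx a)
    exact h.tendsto.comp (tendsto_nhdsWithin_iff.2
      ⟨tendsto_nextGridPoint a, Eventually.of_forall fun n => le_nextGridPoint n a⟩)

/-- Optional sampling: `E[h X_{τ ∧ T}] = E[h X_T]` for a bounded `ℱ_τ`-measurable `h`. -/
theorem integrable_and_integral_mul_stoppedProcess_top {X : Time T → Ω → ℝ}
    (hX : Martingale X ℱ P) (hc : ∀ ω t, ContinuousWithinAt (fun s => X s ω) (Ioi t) t)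
    (hτ : IsStoppingTime ℱ τ) {h : Ω → ℝ} (hm : Measurable[hτ.measurableSpace] h)
    {C : ℝ} (hC : ∀ ω, |h ω| ≤ C) :
    Integrable (fun ω => h ω * stoppedProcess X τ ⊤ ω) P ∧
      ∫ ω, h ω * stoppedProcess X τ ⊤ ω ∂P = ∫ ω, h ω * X ⊤ ω ∂P := by
  have hZ : Integrable (h * X ⊤) P :=
    (hX.integrable ⊤).bdd_mul (hm.mono hτ.measurableSpace_le le_rfl).aestronglyMeasurable
      (Eventually.of_forall hC)
  refine integrable_and_integral_eq_of_tendsto_condExp hZ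
    (fun n => (isStoppingTime_nextGridPoint hτ n).measurableSpace_le) ?_
  have hn : ∀ᵐ ω ∂P, ∀ n, (P[h * X ⊤ | (isStoppingTime_nextGridPoint hτ n).measurableSpace]) ω =
      h ω * X (nextGridPoint n (τ ω)) ω := by
    refine ae_all_iff.2 fun n => ?_
    have h1 := hX.stoppedValue_ae_eq_condExp_of_le_const_of_countable_range (n := ⊤)
      (isStoppingTime_nextGridPoint hτ n) (fun _ => WithTop.coe_le_coe.2 le_top)
      (((countable_range_nextGridPoint n).image _).mono
        (range_subset_iff.2 fun ω => mem_image_of_mem _ (mem_range_self (τ ω))))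
    have h2 := condExp_mul_of_stronglyMeasurable_left (μ := P)
      (hm.mono (measurableSpace_le_nextGridPoint hτ n) le_rfl).stronglyMeasurable hZ
      (hX.integrable ⊤)
    filter_upwards [h1, h2] with ω hω1 hω2
    rw [hω2, Pi.mul_apply, ← hω1]
    rfl
  filter_upwards [hn] with ω hω
  exact ((tendsto_apply_nextGridPoint (hc ω) (τ ω)).const_mul (h ω)).congr fun n => (hω n).symm

end OptionalSampling

/-! ### Simple capital processes under a martingale measure -/

section Capital

variable {T : ℝ} [Fact (0 ≤ T)] {k : Kind}

omit [Fact (0 ≤ T)] in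
theorem continuousWithinAt_coord (ω : Sample T k) (t : Time T) :
    ContinuousWithinAt (fun s => coord s ω) (Ioi t) t := by
  cases k with
  | cadlag => exact ω.2.2.1 t
  | continuous => exact ω.2.2.continuousWithinAt
  | rightContinuous => exact ω.2.2 t

omit [Fact (0 ≤ T)] in
/-- The σ-algebras on the sample space are the traces of those on the base space. -/
theorem comap_toBase_sigma (t : Time T) :
    MeasurableSpace.comap toBase (sigma T k.base t) = sigma T k t := by
  cases k <;> exact MeasurableSpace.comap_comp

theorem measurable_toBase (t : Time T) :
    @Measurable (Sample T k) (Sample T k.base) (filt T k t) (filt T k.base t) toBase :=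
  Measurable.of_comap_le (comap_toBase_sigma t).le

theorem isStoppingTime_comp_toBase {τ : Sample T k.base → WithTop (Time T)}
    (hτ : IsStoppingTime (filt T k.base) τ) :
    IsStoppingTime (filt T k) fun ω => τ (toBase ω) :=
  fun i => measurable_toBase i (hτ i)

/-- The restriction to `Ω` of a trading strategy on the base space. -/
noncomputable def SimpleStrategy.restrict (G : SimpleStrategy T k.base) : SimpleStrategy T k where
  c := G.c
  τ n ω := G.τ n (toBase ω)
  isStoppingTime n := isStoppingTime_comp_toBase (G.isStoppingTime n)
  monotone ω := G.monotone (toBase ω)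
  finite ω := G.finite (toBase ω)
  h n ω := G.h n (toBase ω)
  -- Events of `ℱ_τ` are events of `⨆ t, ℱ t`, which is `ℱ_T`, so they can be pulled back.
  measurable n A hA := by
    obtain ⟨h1, h2⟩ := G.measurable n hA
    have hle : (⨆ t, filt T k.base t) ≤ filt T k.base ⊤ :=
      iSup_le fun t => (filt T k.base).mono le_top
    exact ⟨le_iSup (fun t => (filt T k t : MeasurableSpace (Sample T k))) ⊤ _
      (measurable_toBase ⊤ (hle _ h1)), fun i => measurable_toBase i (h2 i)⟩
  bounded n := (G.bounded n).imp fun _ hC ω => hC (toBase ω)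

theorem SimpleStrategy.capital_restrict (G : SimpleStrategy T k.base) (t : Time T)
    (ω : Sample T k) : G.restrict.capital t ω = G.capital t (toBase ω) := rfl

theorem stoppedProcess_coord_bot (τ : Sample T k → WithTop (Time T)) (ω : Sample T k) :
    stoppedProcess coord τ ⊥ ω = coord ⊥ ω :=
  stoppedProcess_eq_of_le (bot_le : ((⊥ : Time T) : WithTop (Time T)) ≤ τ ω)

theorem SimpleStrategy.capital_bot (G : SimpleStrategy T k) (ω : Sample T k) :
    G.capital ⊥ ω = G.c := by
  simp [capital, stoppedProcess_coord_bot]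

/-- The terminal capital of the strategy that stops trading at its `N`-th stopping time. -/
noncomputable def SimpleStrategy.truncCapital (G : SimpleStrategy T k) (N : ℕ)
    (ω : Sample T k) : ℝ :=
  G.c + ∑ n ∈ Finset.range N, (G.h n ω * stoppedProcess coord (G.τ (n + 1)) ⊤ ω -
    G.h n ω * stoppedProcess coord (G.τ n) ⊤ ω)

theorem min_coe_capTime (s r : WithTop (Time T)) :
    (min (capTime s : WithTop (Time T)) r).untopA = capTime (min s r) := by
  have h : ((⊤ : Time T) : WithTop (Time T)) ⊓ s = capTime s := by
    cases s with
    | top => simp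
    | coe a => rw [capTime_coe]; exact min_eq_right (WithTop.coe_le_coe.2 le_top)
  rw [← h, min_assoc]; rfl

/-- Stopping trade at `τ N` amounts to reading the capital at time `τ N ∧ T`; in particular it
preserves nonnegativity. -/
theorem SimpleStrategy.truncCapital_eq_capital (G : SimpleStrategy T k) (N : ℕ) (ω : Sample T k) :
    G.truncCapital N ω = G.capital (capTime (G.τ N ω)) ω := by
  have hs : ∀ j, stoppedProcess coord (G.τ j) (capTime (G.τ N ω)) ω =
      coord (capTime (G.τ (min N j) ω)) ω := fun j => by
    rw [(G.monotone ω).map_min, ← min_coe_capTime]; rfl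
  rw [capital, truncCapital, finsum_eq_sum_of_support_subset (s := Finset.range N)]
  · refine congrArg _ (Finset.sum_congr rfl fun n hn => ?_)
    have hn := Finset.mem_range.1 hn
    rw [hs, hs, min_eq_right hn.le, min_eq_right (Nat.succ_le_of_lt hn), mul_sub]
    rfl
  -- The increments with `n ≥ N` start and end at `τ N ∧ T`, so they vanish.
  · intro n hn
    by_contra hN
    have hN : N ≤ n := by simpa using hN
    apply hn
    dsimp only
    rw [hs, hs, min_eq_left hN, min_eq_left (hN.trans n.le_succ), sub_self, mul_zero]

theorem SimpleStrategy.eventually_truncCapital_eq (G : SimpleStrategy T k) (ω : Sample T k) :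
    ∀ᶠ N in atTop, G.truncCapital N ω = G.capital ⊤ ω := by
  have hfin : ∀ᶠ N in atTop, G.τ N ω = ⊤ := by
    rw [← Nat.cofinite_eq_atTop]
    exact (G.finite ω).eventually_cofinite_notMem.mono fun _ => not_not.1
  filter_upwards [hfin] with N hN
  rw [G.truncCapital_eq_capital, hN, capTime_top]

variable {P : Measure (Sample T k)} [IsProbabilityMeasure P]

theorem SimpleStrategy.integrable_and_integral_truncCapital (hX : Martingale coord (filt T k) P)
    (G : SimpleStrategy T k) (N : ℕ) :
    Integrable (G.truncCapital N) P ∧ ∫ ω, G.truncCapital N ω ∂P = G.c := by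
  have key : ∀ n, Integrable (fun ω => G.h n ω * stoppedProcess coord (G.τ (n + 1)) ⊤ ω -
      G.h n ω * stoppedProcess coord (G.τ n) ⊤ ω) P ∧
      ∫ ω, (G.h n ω * stoppedProcess coord (G.τ (n + 1)) ⊤ ω -
        G.h n ω * stoppedProcess coord (G.τ n) ⊤ ω) ∂P = 0 := by
    intro n
    obtain ⟨C, hC⟩ := G.bounded n
    have h1 := integrable_and_integral_mul_stoppedProcess_top hX continuousWithinAt_coord
      (G.isStoppingTime n) (G.measurable n) hC
    -- `h n` is also measurable at the later time `τ (n + 1)`, so both expectations of the product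
    -- are equal to `E[h n X_T]`.
    have h2 := integrable_and_integral_mul_stoppedProcess_top hX continuousWithinAt_coord
      (G.isStoppingTime (n + 1)) ((G.measurable n).mono
        (IsStoppingTime.measurableSpace_mono _ _ fun ω => G.monotone ω n.le_succ) le_rfl) hC
    exact ⟨h2.1.sub h1.1, by rw [integral_sub h2.1 h1.1, h1.2, h2.2, sub_self]⟩
  have hsum := integrable_finsetSum (Finset.range N) fun n _ => (key n).1
  refine ⟨(integrable_const G.c).add hsum, ?_⟩
  simp only [truncCapital]
  rw [integral_add (integrable_const _) hsum, integral_finsetSum _ fun n _ => (key n).1]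
  simp [key]

theorem SimpleStrategy.aemeasurable_capital_top (hX : Martingale coord (filt T k) P)
    (G : SimpleStrategy T k) : AEMeasurable (G.capital ⊤) P :=
  aemeasurable_of_tendsto_metrizable_ae atTop
    (fun N => (G.integrable_and_integral_truncCapital hX N).1.aemeasurable)
    (Eventually.of_forall fun ω => tendsto_const_nhds.congr'
      ((G.eventually_truncCapital_eq ω).mono fun _ h => h.symm))

theorem SimpleStrategy.lintegral_capital_top_le (hX : Martingale coord (filt T k) P)
    (G : SimpleStrategy T k) (hG : ∀ t ω, 0 ≤ G.capital t ω) :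
    ∫⁻ ω, ENNReal.ofReal (G.capital ⊤ ω) ∂P ≤ ENNReal.ofReal G.c := by
  have hlim : ∀ ω, liminf (fun N => ENNReal.ofReal (G.truncCapital N ω)) atTop =
      ENNReal.ofReal (G.capital ⊤ ω) := fun ω =>
    (tendsto_const_nhds.congr' ((G.eventually_truncCapital_eq ω).mono
      fun _ h => by rw [h])).liminf_eq
  have hN : ∀ N, ∫⁻ ω, ENNReal.ofReal (G.truncCapital N ω) ∂P = ENNReal.ofReal G.c := by
    intro N
    obtain ⟨h1, h2⟩ := G.integrable_and_integral_truncCapital hX N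
    rw [← h2, ofReal_integral_eq_lintegral_ofReal h1 (Eventually.of_forall fun ω => ?_)]
    rw [G.truncCapital_eq_capital]
    exact hG _ _
  calc ∫⁻ ω, ENNReal.ofReal (G.capital ⊤ ω) ∂P
      = ∫⁻ ω, liminf (fun N => ENNReal.ofReal (G.truncCapital N ω)) atTop ∂P := by simp only [hlim]
    _ ≤ liminf (fun N => ∫⁻ ω, ENNReal.ofReal (G.truncCapital N ω) ∂P) atTop :=
        lintegral_liminf_le' fun N =>
          (G.integrable_and_integral_truncCapital hX N).1.aemeasurable.ennreal_ofReal
    _ = ENNReal.ofReal G.c := by simp only [hN, liminf_const]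

/-! ### Positive capital processes and upper probability -/

/-- A positive capital process is a supermartingale between the times `0` and `T`: its expected
terminal value is at most its initial value. -/
theorem IsPositiveCapitalProcess.lintegral_top_le (hX : Martingale coord (filt T k) P)
    {S : Time T → Sample T k → ℝ≥0∞} (hS : IsPositiveCapitalProcess S) (ω₀ : Sample T k) :
    ∫⁻ ω, S ⊤ ω ∂P ≤ S ⊥ ω₀ := by
  obtain ⟨-, G, hG, -, hSG⟩ := hS
  simp only [hSG, SimpleStrategy.capital_bot, ← SimpleStrategy.capital_restrict]
  rw [lintegral_tsum fun n => ((G n).restrict.aemeasurable_capital_top hX).ennreal_ofReal]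
  exact ENNReal.tsum_le_tsum fun n => (G n).restrict.lintegral_capital_top_le hX (hG n)

/-- The strategy that never trades. -/
noncomputable def SimpleStrategy.const (T : ℝ) [Fact (0 ≤ T)] (k : Kind) (c : ℝ) :
    SimpleStrategy T k where
  c := c
  τ _ _ := ⊤
  isStoppingTime _ i := by simp
  monotone _ := monotone_const
  finite _ := by simp
  h _ _ := 0
  measurable _ := measurable_const
  bounded _ := ⟨0, by simp⟩

theorem SimpleStrategy.capital_const (c : ℝ) (t : Time T) (ω : Sample T k) :
    (SimpleStrategy.const T k c).capital t ω = c := by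
  simp [capital, const]

theorem isPositiveCapitalProcess_one :
    IsPositiveCapitalProcess fun (_ : Time T) (_ : Sample T k) => (1 : ℝ≥0∞) := by
  refine ⟨fun _ => measurable_const,
    fun n => SimpleStrategy.const T k.base (if n = 0 then 1 else 0), fun n t ω => ?_, ?_,
    fun t ω => ?_⟩
  · rw [SimpleStrategy.capital_const]
    split_ifs <;> simp
  · exact summable_of_ne_finset_zero (s := {0}) fun n hn => by
      simp only [SimpleStrategy.const]
      rw [if_neg (by simpa using hn)]
  · simp only [SimpleStrategy.capital_const]
    rw [tsum_eq_single 0 fun n hn => by simp [hn]]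
    simp

theorem upperProb_le_one (E : Set (Sample T k)) : upperProb E ≤ 1 :=
  sInf_le ⟨_, isPositiveCapitalProcess_one, fun _ => rfl,
    fun ω => indicator_le_self' (fun _ _ => zero_le_one) ω⟩

theorem le_upperProb (hX : Martingale coord (filt T k) P) {E : Set (Sample T k)}
    (hE : MeasurableSet E) : P E ≤ upperProb E := by
  refine le_sInf ?_
  rintro x ⟨S, hS, hS0, hSE⟩
  obtain ⟨ω₀⟩ : Nonempty (Sample T k) := nonempty_of_isProbabilityMeasure P
  calc P E = ∫⁻ ω, E.indicator (fun _ => (1 : ℝ≥0∞)) ω ∂P := (lintegral_indicator_one hE).symm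
    _ ≤ ∫⁻ ω, S ⊤ ω ∂P := lintegral_mono hSE
    _ ≤ S ⊥ ω₀ := hS.lintegral_top_le hX ω₀
    _ = x := hS0 ω₀

theorem Typically.ae (hX : Martingale coord (filt T k) P) {p : Sample T k → Prop}
    (hp : Typically p) : ∀ᵐ ω ∂P, p ω := by
  obtain ⟨S, hS, hS0, hSp⟩ := hp
  obtain ⟨ω₀⟩ : Nonempty (Sample T k) := nonempty_of_isProbabilityMeasure P
  have hle : ∫⁻ ω, S ⊤ ω ∂P ≤ 1 := (hS.lintegral_top_le hX ω₀).trans_eq (hS0 ω₀)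
  filter_upwards [ae_lt_top (hS.1 ⊤) (hle.trans_lt ENNReal.one_lt_top).ne] with ω hω
  by_contra h
  exact hω.ne (hSp ω h)

end Capital

end GameProb

theorem mainTheorem7 (T : ℝ) [Fact (0 ≤ T)] (k : GameProb.Kind)
    (P : MeasureTheory.Measure (GameProb.Sample T k)) [MeasureTheory.IsProbabilityMeasure P]
    (hX : MeasureTheory.Martingale GameProb.coord (GameProb.filt T k) P) :
    (∀ E : Set (GameProb.Sample T k), MeasurableSet E → P E = 1 → GameProb.upperProb E = 1) ∧
    (∀ p : GameProb.Sample T k → Prop, GameProb.Typically p → ∀ᵐ ω ∂P, p ω) :=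
  ⟨fun E hE hPE => (GameProb.upperProb_le_one E).antisymm (hPE ▸ GameProb.le_upperProb hX hE),
    fun _ hp => hp.ae hX⟩
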